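/- A crossed module $(H,G,\mu)$ is a group homomorphism $\mu\colon H\to G$ together with an action of $G$ on $H$ by automorphisms such that $\mu({}^g h)=g\mu(h)g^{-1}$ and ${}^{\mu(h)}h'=hh'h^{-1}$ for all $g\in G$, $h,h'\in H$. Its nerve $\mathrm{Ner}_*(H,G,\mu)$ is the simplicial group obtained as the nerve of the internal category in groups with group of objects $G$ and group of arrows $H\rtimes G$, where $(h,g)$ is an arrow from $g$ to $\mu(h)g$ and $(h',\mu(h)g)\circ(h,g)=(h'h,g)$. For $n\ge 0$, the homology group with integral coefficients $H_n(H,G,\mu)$ is the $n$th homology group of the total complex of the bicomplex of abelian groups whose $p$th column is $B_*(\mathrm{Ner}_p(H,G,\mu))\otimes_{\mathrm{Ner}_p(H,G,\mu)}\mathbb Z$ (where $B_*(K)$ is the bar resolution of $\mathbb Z$ over a group $K$, and $\mathbb Z$ carries the trivial action), and whose horizontal differentials are the alternating sums of the maps induced by the face homomorphisms of the nerve. A free crossed module (with respect to $\mathsf{Set}$) is one isomorphic to the value at some set $X$ of the left adjoint of the functor $(H,G,\mu)\mapsto H\times G$ from crossed modules to sets; that is, isomorphic to the inclusion crossed module $\operatorname{Ker}\big((0,1)\colon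 F_X * F_X\to F_X\big)\hookrightarrow F_X * F_X$, with action by conjugation, where $F_X$ is the free group on $X$. A free presentation of $(H,G,\mu)$ is a short exact sequence of crossed modules $$0\to (R',F',\eta')\to (R,F,\eta)\to (H,G,\mu)\to 0$$ (exact in both components) in which $(R,F,\eta)$ is free; one regards $F'$ as a normal subgroup of $F$. **Corollary (Hopf Formula).** For any free presentation $0\to (R',F',\eta')\to (R,F,\eta)\to (H,G,\mu)\to 0$ of a crossed module $(H,G,\mu)$, there is an isomorphism of groups $$H_2(H,G,\mu)\;\cong\;\frac{(\eta(R)\cdot[F,F])\cap F'}{\eta'(R')\cdot[F,F']}.$$ -/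

import Mathlib

open CategoryTheory

universe u

/-- A crossed module `(H, G, μ)`: a homomorphism `μ : H → G` together with an action of `G` on `H`
by automorphisms satisfying the precrossed module identity and the Peiffer identity. -/
structure CrossedModule (H G : Type u) [Group H] [Group G] where
  /-- the structure homomorphism `μ` -/
  hom : H →* G
  /-- the action of `G` on `H` -/
  act : G →* MulAut H
  hom_act : ∀ (g : G) (h : H), hom (act g h) = g * hom h * g⁻¹
  peiffer : ∀ h h' : H, act (hom h) h' = h * h' * h⁻¹

namespace CrossedModule

/-- A morphism of crossed modules: a commutative square of group homomorphisms that is compatible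
with the actions. -/
structure Hom {H G H' G' : Type u} [Group H] [Group G] [Group H'] [Group G']
    (M : CrossedModule H G) (M' : CrossedModule H' G') where
  /-- the component `H → H'` -/
  left : H →* H'
  /-- the component `G → G'` -/
  right : G →* G'
  comm : ∀ h : H, M'.hom (left h) = right (M.hom h)
  equivariant : ∀ (g : G) (h : H), left (M.act g h) = M'.act (right g) (left h)

/-- The inclusion crossed module of a normal subgroup, with the conjugation action. -/
def inclusion {G : Type u} [Group G] (N : Subgroup G) [N.Normal] : CrossedModule N G where
  hom := N.subtype
  act := MulAut.conjNormal
  hom_act _ _ := rfl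
  peiffer _ _ := by
    ext
    rfl

/-- The free crossed module on a set `X`, i.e. the value at `X` of the left adjoint of the functor
which sends `(H, G, μ)` to the set `H × G`. With `F_X` the free group on `X`, it is the inclusion
crossed module of the kernel of the retraction `(0, 1) : F_X ∗ F_X → F_X` (this kernel is the normal
closure of the first free factor). -/
def free (X : Type u) :
    CrossedModule (Monoid.Coprod.snd : Monoid.Coprod (FreeGroup X) (FreeGroup X) →* FreeGroup X).ker
      (Monoid.Coprod (FreeGroup X) (FreeGroup X)) :=
  inclusion _

/-- A crossed module is free (with respect to sets) if it is isomorphic to the free crossed module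
on some set. -/
def IsFree {H G : Type u} [Group H] [Group G] (M : CrossedModule H G) : Prop :=
  ∃ (X : Type u) (f : Hom (free X) M), Function.Bijective f.left ∧ Function.Bijective f.right

/-- A short exact sequence `0 → M' → M → M'' → 0` of crossed modules: in both components, the first
map is the kernel of the second one, and the second map is the cokernel of the first one. -/
structure ShortExact {H' G' H G H'' G'' : Type u} [Group H'] [Group G'] [Group H] [Group G]
    [Group H''] [Group G''] (M' : CrossedModule H' G') (M : CrossedModule H G)
    (M'' : CrossedModule H'' G'') where
  incl : Hom M' M
  proj : Hom M M''
  incl_left_injective : Function.Injective incl.left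
  incl_right_injective : Function.Injective incl.right
  exact_left : incl.left.range = proj.left.ker
  exact_right : incl.right.range = proj.right.ker
  proj_left_surjective : Function.Surjective proj.left
  proj_right_surjective : Function.Surjective proj.right

/-- A free presentation of `N`: a short exact sequence `0 → M' → M → N → 0` with `M` free. -/
structure FreePresentation {R' F' R F H G : Type u} [Group R'] [Group F'] [Group R] [Group F]
    [Group H] [Group G] (M' : CrossedModule R' F') (M : CrossedModule R F)
    (N : CrossedModule H G) extends ShortExact M' M N where
  isFree : M.IsFree

/-! ### The two subgroups in the Hopf formula -/

namespace ShortExact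

variable {R' F' R F H G : Type u} [Group R'] [Group F'] [Group R] [Group F] [Group H] [Group G]
  {M' : CrossedModule R' F'} {M : CrossedModule R F} {N : CrossedModule H G}

/-- The subgroup `(η(R)·[F, F]) ∩ F'` of `F`, where `F'` is identified with its image in `F`. -/
def hopfNumerator (S : ShortExact M' M N) : Subgroup F :=
  (M.hom.range ⊔ ⁅(⊤ : Subgroup F), (⊤ : Subgroup F)⁆) ⊓ S.incl.right.range

/-- The subgroup `η'(R')·[F, F']` of `F`, where `F'` is identified with its image in `F`. -/
def hopfDenominator (S : ShortExact M' M N) : Subgroup F :=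
  M'.hom.range.map S.incl.right ⊔ ⁅(⊤ : Subgroup F), S.incl.right.range⁆

instance hopfDenominator_normal (S : ShortExact M' M N) : S.hopfDenominator.Normal := by
  have h1 : S.incl.right.range.Normal := by
    rw [S.exact_right]
    infer_instance
  have h2 : (M'.hom.range.map S.incl.right).Normal := by
    constructor
    rintro _ ⟨_, ⟨r, rfl⟩, rfl⟩ f
    have hk : M.act f (S.incl.left r) ∈ S.incl.left.range := by
      have hr : S.incl.left r ∈ S.proj.left.ker := S.exact_left ▸ ⟨r, rfl⟩
      rw [S.exact_left, MonoidHom.mem_ker, S.proj.equivariant, MonoidHom.mem_ker.mp hr, map_one]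
    obtain ⟨r', hr'⟩ := hk
    refine ⟨_, ⟨r', rfl⟩, ?_⟩
    rw [← S.incl.comm, hr', M.hom_act, S.incl.comm]
  unfold hopfDenominator
  infer_instance

theorem hopfDenominator_le_hopfNumerator (S : ShortExact M' M N) :
    S.hopfDenominator ≤ S.hopfNumerator := by
  have h1 : S.incl.right.range.Normal := by
    rw [S.exact_right]
    infer_instance
  refine sup_le (le_inf ?_ ?_) (le_inf ?_ ?_)
  · rintro _ ⟨_, ⟨r, rfl⟩, rfl⟩
    exact Subgroup.mem_sup_left ⟨S.incl.left r, S.incl.comm r⟩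
  · rintro _ ⟨f, _, rfl⟩
    exact ⟨f, rfl⟩
  · exact (Subgroup.commutator_mono le_rfl le_top).trans le_sup_right
  · exact Subgroup.commutator_le_right _ _

end ShortExact

/-! ### The nerve of a crossed module -/

section Nerve

variable {H G : Type u} [Group H] [Group G] (M : CrossedModule H G)

/-- The `n`-simplices of the nerve of the internal category in groups associated with `(H, G, μ)`.
Its group of objects is `G` and its group of arrows is `H ⋊ G`, where `(h, g)` is an arrow from `g`
to `μ(h) g`, and `(h', g') ∘ (h, g) = (h' h, g)` if `g' = μ(h) g`. An `n`-simplex consists of objects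
`x.1 i` for `0 ≤ i ≤ n` and arrows `x.2 (i, j) : x.1 j → x.1 i` for `i ≤ j`, compatible with
identities and composition; the group structure is componentwise. A simplex is determined by
`h_i := (x.2 (i - 1, i)).left` and `g := x.1 n`, in agreement with the description of the
`n`-simplices as the elements `(h_1, …, h_n, g)` of `H ⋊ (⋯ (H ⋊ G) ⋯)`. -/
def nerveGroup (n : ℕ) :
    Subgroup ((Fin (n + 1) → G) ×
      ({p : Fin (n + 1) × Fin (n + 1) // p.1 ≤ p.2} → H ⋊[M.act] G)) where
  carrier := {x |
    (∀ p, (x.2 p).right = x.1 p.1.2) ∧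
    (∀ p, M.hom (x.2 p).left * (x.2 p).right = x.1 p.1.1) ∧
    (∀ i, (x.2 ⟨(i, i), le_rfl⟩).left = 1) ∧
    (∀ (i j k : Fin (n + 1)) (hij : i ≤ j) (hjk : j ≤ k),
      (x.2 ⟨(i, k), hij.trans hjk⟩).left = (x.2 ⟨(i, j), hij⟩).left * (x.2 ⟨(j, k), hjk⟩).left)}
  one_mem' := by simp
  mul_mem' := by
    rintro x y ⟨hx1, hx2, hx3, hx4⟩ ⟨hy1, hy2, hy3, hy4⟩
    refine ⟨fun p => ?_, fun p => ?_, fun i => ?_, fun i j k hij hjk => ?_⟩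
    · simp [hx1, hy1]
    · simp [← hx2, ← hy2, M.hom_act, mul_assoc]
    · simp [hx3, hy3]
    · have h : x.1 j = M.hom (x.2 ⟨(j, k), hjk⟩).left * x.1 k := by
        rw [← hx2 ⟨(j, k), hjk⟩, hx1]
      simp [hx1, hx4 i j k hij hjk, hy4 i j k hij hjk, h, M.peiffer, mul_assoc]
  inv_mem' := by
    rintro x ⟨hx1, hx2, hx3, hx4⟩
    have hi : ∀ p, (x⁻¹.2 p).left = M.act (x.2 p).right⁻¹ (x.2 p).left⁻¹ := fun _ => rfl
    refine ⟨fun p => ?_, fun p => ?_, fun i => ?_, fun i j k hij hjk => ?_⟩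
    · simp [hx1]
    · rw [hi, M.hom_act]
      simp [← hx2]
    · simp [hx3]
    · have h : x.1 j = M.hom (x.2 ⟨(j, k), hjk⟩).left * x.1 k := by
        rw [← hx2 ⟨(j, k), hjk⟩, hx1]
      rw [hi, hi, hi, hx4 i j k hij hjk]
      simp only [hx1, h, mul_inv_rev, map_mul, MulAut.mul_apply, ← map_inv M.hom, M.peiffer]
      simp [mul_assoc]

/-- Restriction of simplices of the nerve along a monotone map. -/
def nerveMap {m n : ℕ} (θ : Fin (m + 1) →o Fin (n + 1)) : M.nerveGroup n →* M.nerveGroup m where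
  toFun x := ⟨(fun i => x.1.1 (θ i), fun p => x.1.2 ⟨(θ p.1.1, θ p.1.2), θ.monotone p.2⟩),
    fun _ => x.2.1 _, fun _ => x.2.2.1 _, fun _ => x.2.2.2.1 _,
    fun _ _ _ _ _ => x.2.2.2.2 _ _ _ _ _⟩
  map_one' := rfl
  map_mul' _ _ := rfl

/-- The nerve of a crossed module, as a simplicial group. -/
def nerve : SimplicialObject GrpCat.{u} where
  obj n := GrpCat.of (M.nerveGroup n.unop.len)
  map f := GrpCat.ofHom (M.nerveMap f.unop.toOrderHom)
  map_id _ := rfl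
  map_comp _ _ := rfl

end Nerve

end CrossedModule

/-! ### Homology of simplicial groups and of crossed modules with integral coefficients -/

noncomputable section

/-- The ring of integers, in the universe `u`. -/
abbrev IntCoeff : Type u := ULift.{u} ℤ

/-- The identity of the trivial module `ℤ`, as an equivariant map along a homomorphism `G → G'`. -/
def trivialRes {G G' : Type u} [Group G] [Group G'] (f : G →* G') :
    Rep.trivial IntCoeff.{u} G IntCoeff.{u} ⟶
      Rep.res f (Rep.trivial IntCoeff.{u} G' IntCoeff.{u}) :=
  Rep.ofHom ⟨LinearMap.id, fun _ => rfl⟩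

/-- The functor sending a group `G` to the complex `B_*(G) ⊗_G ℤ` computing the homology of `G` with
coefficients in the trivial module `ℤ` (the bar complex, in its inhomogeneous form: its term of
degree `m` is the free abelian group on `G ^ m`). -/
def integralBarComplex : GrpCat.{u} ⥤ ChainComplex (ModuleCat.{u} IntCoeff.{u}) ℕ where
  obj G := groupHomology.inhomogeneousChains (Rep.trivial IntCoeff.{u} G IntCoeff.{u})
  map f := groupHomology.chainsMap f.hom (trivialRes f.hom)
  map_id _ := groupHomology.chainsMap_id
  map_comp f g := by
    rw [← groupHomology.chainsMap_comp]
    exact groupHomology.chainsMap_congr rfl rfl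

/-- The bicomplex `B(G_*, ℤ)` of a simplicial group `G_*` acting trivially on the constant simplicial
abelian group `ℤ`: its `p`-th column is `B_*(G_p) ⊗_{G_p} ℤ`, and its horizontal differentials are the
alternating sums of the face maps. -/
def integralBicomplex (X : SimplicialObject GrpCat.{u}) :
    HomologicalComplex₂ (ModuleCat.{u} IntCoeff.{u}) (ComplexShape.down ℕ) (ComplexShape.down ℕ) :=
  (AlgebraicTopology.alternatingFaceMapComplex _).obj (X ⋙ integralBarComplex)

/-- The `n`-th homology group `H_n(H, G, μ)` of a crossed module with integral coefficients: the
homology of the total complex of the bicomplex `B(Ner_*(H, G, μ), ℤ)`. -/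
def CrossedModule.integralHomology {H G : Type u} [Group H] [Group G] (M : CrossedModule H G)
    (n : ℕ) : ModuleCat.{u} IntCoeff.{u} :=
  ((integralBicomplex M.nerve).total (ComplexShape.down ℕ)).homology n

end

/-! Both sides are computed by one invariant of central extensions. Consider central extensions `D →
G` equipped with an equivariant lift `H → D` of `μ` (`CentralExtension`), and attach to each the
subgroup `(im H · [D, D]) ∩ ker (D → G)`. Two morphisms between such extensions differ by central
factors, which cancel in commutators, and they agree on `im H`; hence they agree on this subgroup
(`IsHom.eqOn_hopfSubgroup`). So any two extensions with morphisms in both directions have isomorphic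
Hopf subgroups, even when these morphisms are far from unique.

Two extensions are weakly initial. The first is `F` modulo the denominator of the formula: freeness
supplies the morphisms (`exists_isHom_of_isFree`), and its Hopf subgroup is the quotient in the
theorem (`hopfQuotientEquiv`). The second is built from total chains of degree 2 modulo boundaries.
There the bar generators `[g, k]` form a 2-cocycle on `G`, and the generators given by arrows of the
nerve provide the lift of `H`. A set-theoretic section of any other extension yields a morphism out
of it (`exists_isHom_universal`). Its Hopf subgroup consists exactly of the classes with zero
boundary (`mem_hopfSubgroup_iff`), that is, of `H_2`. -/

noncomputable section

/-! ### The total complex of the bar bicomplex of a simplicial group -/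

namespace SimplicialGroup

variable (X : SimplicialObject GrpCat.{u})

/-- The basis element of bidegree `(p, q)` of the bicomplex `B(X, ℤ)` given by `v ∈ X_p ^ q`. -/
def cell (p q : ℕ) (v : Fin q → X.obj (.op (.mk p))) : ((integralBicomplex X).X p).X q :=
  (Finsupp.single v (1 : IntCoeff.{u}) : (Fin q → X.obj (.op (.mk p))) →₀ IntCoeff.{u})

lemma cell_hom_ext {p q : ℕ} {A : ModuleCat.{u} IntCoeff.{u}}
    {f g : ((integralBicomplex X).X p).X q ⟶ A} (h : ∀ v, f (cell X p q v) = g (cell X p q v)) :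
    f = g := by
  apply ModuleCat.hom_ext
  refine Finsupp.lhom_ext' (R := IntCoeff.{u}) (M := IntCoeff.{u}) fun v => ?_
  apply LinearMap.ext_ring
  exact h v

lemma lift_single_one {R α : Type*} [Ring R] {A : ModuleCat R} (f : α → A) (a : α) :
    Finsupp.lift A R α f (Finsupp.single a 1) = f a := by
  simp

/-- The morphism out of the `(p, q)`-term of the bicomplex with prescribed values on `cell`s. -/
def cellDesc {p q : ℕ} {A : ModuleCat.{u} IntCoeff.{u}}
    (f : (Fin q → X.obj (.op (.mk p))) → A) : ((integralBicomplex X).X p).X q ⟶ A :=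
  ModuleCat.ofHom (Finsupp.lift A IntCoeff.{u} (Fin q → X.obj (.op (.mk p))) f)

lemma cellDesc_cell {p q : ℕ} {A : ModuleCat.{u} IntCoeff.{u}}
    (f : (Fin q → X.obj (.op (.mk p))) → A) (v : Fin q → X.obj (.op (.mk p))) :
    cellDesc X f (cell X p q v) = f v :=
  lift_single_one f v

lemma sum_zsmul_hom_apply {ι : Type*} (s : Finset ι) {A B : ModuleCat.{u} IntCoeff.{u}}
    (c : ι → ℤ) (f : ι → (A ⟶ B)) (a : A) :
    (∑ i ∈ s, c i • f i) a = ∑ i ∈ s, c i • f i a := by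
  simp [ModuleCat.hom_sum]

lemma sum_zsmul_hom_f {ι : Type*} (s : Finset ι)
    {K L : ChainComplex (ModuleCat.{u} IntCoeff.{u}) ℕ}
    (c : ι → ℤ) (f : ι → (K ⟶ L)) (n : ℕ) :
    (∑ i ∈ s, c i • f i).f n = ∑ i ∈ s, c i • (f i).f n := by
  classical
  induction s using Finset.induction_on with
  | empty => simp
  | insert a s ha ih => rw [Finset.sum_insert ha, Finset.sum_insert ha, ← ih]; rfl

/-! ### Differentials of the bicomplex and of its total complex on basis elements -/

lemma d_cell_horizontal (p q : ℕ) (v : Fin q → X.obj (.op (.mk (p + 1)))) :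
    ((integralBicomplex X).d (p + 1) p).f q (cell X (p + 1) q v) =
      ∑ i : Fin (p + 2), (-1 : ℤ) ^ (i : ℕ) • cell X p q (fun j => X.δ i (v j)) := by
  have h : (integralBicomplex X).d (p + 1) p = ∑ i : Fin (p + 2), (-1 : ℤ) ^ (i : ℕ) •
      SimplicialObject.δ (X ⋙ integralBarComplex) i := by
    simp [integralBicomplex]
  have h' : ((integralBicomplex X).d (p + 1) p).f q = ∑ i : Fin (p + 2), (-1 : ℤ) ^ (i : ℕ) •
      (SimplicialObject.δ (X ⋙ integralBarComplex) i).f q :=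
    (congrArg (fun g => HomologicalComplex.Hom.f g q) h).trans (sum_zsmul_hom_f _ _ _ _)
  rw [h']
  refine (sum_zsmul_hom_apply _ _ _ _).trans (Finset.sum_congr rfl fun i _ => ?_)
  exact congrArg _ (groupHomology.chainsMap_f_single _ _ _ _ _)

lemma d_cell_vertical (p q : ℕ) (v : Fin (q + 1) → X.obj (.op (.mk p))) :
    ((integralBicomplex X).X p).d (q + 1) q (cell X p (q + 1) v) =
      cell X p q (fun i => v i.succ) + ∑ j : Fin (q + 1), (-1 : ℤ) ^ ((j : ℕ) + 1) •
        cell X p q (Fin.contractNth j (· * ·) v) := by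
  have h : ((integralBicomplex X).X p).d (q + 1) q = groupHomology.inhomogeneousChains.d
      (Rep.trivial IntCoeff.{u} (X.obj (.op (.mk p))) IntCoeff.{u}) q :=
    groupHomology.inhomogeneousChains.d_def _ _
  rw [h]
  refine (groupHomology.inhomogeneousChains.d_single _ _ _).trans ?_
  congr 1

/-- The total complex of the bicomplex `B(X, ℤ)`. -/
abbrev tot : ChainComplex (ModuleCat.{u} IntCoeff.{u}) ℕ :=
  (integralBicomplex X).total (ComplexShape.down ℕ)

/-- The inclusion of a summand of the total complex. -/
abbrev ι (p q n : ℕ) (h : p + q = n) : ((integralBicomplex X).X p).X q ⟶ (tot X).X n :=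
  (integralBicomplex X).ιTotal (ComplexShape.down ℕ) p q n h

/-- The edges of the quadrant need separate versions, since there one of the two differentials has
no target. -/
lemma ι_d (p q p' q' n : ℕ) (hp : p' + 1 = p) (hq : q' + 1 = q) (h : p + q = n + 1) :
    ι X p q (n + 1) h ≫ (tot X).d (n + 1) n =
      ((integralBicomplex X).d p p').f q ≫ ι X p' q n (by omega) +
      (-1 : ℤ) ^ p • (((integralBicomplex X).X p).d q q' ≫ ι X p q' n (by omega)) := by
  rw [HomologicalComplex₂.total_d, Preadditive.comp_add, HomologicalComplex₂.ι_D₁,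
    HomologicalComplex₂.ι_D₂, HomologicalComplex₂.d₁_eq _ _ (i₁' := p') hp _ _ (by simp; omega),
    HomologicalComplex₂.d₂_eq _ _ _ (i₂' := q') hq _ (by simp; omega)]
  congr 1
  exact one_smul _ _

lemma ι_d_left (p p' n : ℕ) (hp : p' + 1 = p) (h : p + 0 = n + 1) :
    ι X p 0 (n + 1) h ≫ (tot X).d (n + 1) n =
      ((integralBicomplex X).d p p').f 0 ≫ ι X p' 0 n (by omega) := by
  rw [HomologicalComplex₂.total_d, Preadditive.comp_add, HomologicalComplex₂.ι_D₁,
    HomologicalComplex₂.ι_D₂, HomologicalComplex₂.d₁_eq _ _ (i₁' := p') hp _ _ (by simp; omega),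
    HomologicalComplex₂.d₂_eq_zero _ _ _ _ _ (by simp), add_zero]
  exact one_smul _ _

lemma ι_d_right (q q' n : ℕ) (hq : q' + 1 = q) (h : 0 + q = n + 1) :
    ι X 0 q (n + 1) h ≫ (tot X).d (n + 1) n =
      ((integralBicomplex X).X 0).d q q' ≫ ι X 0 q' n (by omega) := by
  rw [HomologicalComplex₂.total_d, Preadditive.comp_add, HomologicalComplex₂.ι_D₁,
    HomologicalComplex₂.ι_D₂, HomologicalComplex₂.d₁_eq_zero _ _ _ _ _ (by simp),
    HomologicalComplex₂.d₂_eq _ _ _ (i₂' := q') hq _ (by simp; omega), zero_add]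
  exact one_smul _ _

/-- The basis element of the total complex given by `v ∈ X_p ^ q`. -/
def gen (p q n : ℕ) (h : p + q = n) (v : Fin q → X.obj (.op (.mk p))) : (tot X).X n :=
  ι X p q n h (cell X p q v)

lemma gen_hom_ext {n : ℕ} {A : ModuleCat.{u} IntCoeff.{u}} {f g : (tot X).X n ⟶ A}
    (h : ∀ p q h v, f (gen X p q n h v) = g (gen X p q n h v)) : f = g := by
  refine HomologicalComplex₂.total.hom_ext _ fun p q hpq => cell_hom_ext _ fun v => ?_
  exact h p q hpq v

lemma exists_gen_desc {n : ℕ} {A : ModuleCat.{u} IntCoeff.{u}}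
    (f : ∀ p q, p + q = n → (Fin q → X.obj (.op (.mk p))) → A) :
    ∃ φ : (tot X).X n ⟶ A, ∀ p q h v, φ (gen X p q n h v) = f p q h v := by
  refine ⟨HomologicalComplex₂.totalDesc _ fun p q h => cellDesc X (f p q h), fun p q h v => ?_⟩
  refine (ConcreteCategory.congr_hom ((integralBicomplex X).ι_totalDesc _ p q h) _).trans ?_
  exact cellDesc_cell _ _ _

lemma d_gen (p q p' q' n : ℕ) (hp : p' + 1 = p) (hq : q' + 1 = q) (h : p + q = n + 1)
    (v : Fin q → X.obj (.op (.mk p))) :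
    (tot X).d (n + 1) n (gen X p q (n + 1) h v) =
      ι X p' q n (by omega) (((integralBicomplex X).d p p').f q (cell X p q v)) +
      (-1 : ℤ) ^ p • ι X p q' n (by omega) (((integralBicomplex X).X p).d q q' (cell X p q v)) :=
  ConcreteCategory.congr_hom (ι_d X p q p' q' n hp hq h) (cell X p q v)

lemma d_gen_left (p p' n : ℕ) (hp : p' + 1 = p) (h : p + 0 = n + 1)
    (v : Fin 0 → X.obj (.op (.mk p))) :
    (tot X).d (n + 1) n (gen X p 0 (n + 1) h v) =
      ι X p' 0 n (by omega) (((integralBicomplex X).d p p').f 0 (cell X p 0 v)) :=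
  ConcreteCategory.congr_hom (ι_d_left X p p' n hp h) (cell X p 0 v)

lemma d_gen_right (q q' n : ℕ) (hq : q' + 1 = q) (h : 0 + q = n + 1)
    (v : Fin q → X.obj (.op (.mk 0))) :
    (tot X).d (n + 1) n (gen X 0 q (n + 1) h v) =
      ι X 0 q' n (by omega) (((integralBicomplex X).X 0).d q q' (cell X 0 q v)) :=
  ConcreteCategory.congr_hom (ι_d_right X q q' n hq h) (cell X 0 q v)

/-! ### Explicit differentials in low degrees -/

lemma d_cell_one (p : ℕ) (v : Fin 1 → X.obj (.op (.mk p))) :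
    ((integralBicomplex X).X p).d 1 0 (cell X p 1 v) = 0 := by
  rw [d_cell_vertical, Fin.sum_univ_one,
    Subsingleton.elim (Fin.contractNth _ _ _) fun i => v i.succ]
  simp

lemma d_cell_two (p : ℕ) (g h : X.obj (.op (.mk p))) :
    ((integralBicomplex X).X p).d 2 1 (cell X p 2 ![g, h]) =
      cell X p 1 ![h] - cell X p 1 ![g * h] + cell X p 1 ![g] := by
  have h0 : (fun i : Fin 1 => ![g, h] i.succ) = ![h] := by ext i; fin_cases i; rfl
  have h1 : Fin.contractNth (0 : Fin 2) (· * ·) ![g, h] = ![g * h] := by ext i; fin_cases i; rfl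
  have h2 : Fin.contractNth (1 : Fin 2) (· * ·) ![g, h] = ![g] := by ext i; fin_cases i; rfl
  rw [d_cell_vertical, Fin.sum_univ_two, h0, h1, h2]
  simp [sub_eq_add_neg, add_assoc]

lemma d_cell_three (p : ℕ) (g h k : X.obj (.op (.mk p))) :
    ((integralBicomplex X).X p).d 3 2 (cell X p 3 ![g, h, k]) =
      cell X p 2 ![h, k] - cell X p 2 ![g * h, k] + cell X p 2 ![g, h * k] -
        cell X p 2 ![g, h] := by
  have h0 : (fun i : Fin 2 => ![g, h, k] i.succ) = ![h, k] := by ext i; fin_cases i <;> rfl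
  have h1 : Fin.contractNth (0 : Fin 3) (· * ·) ![g, h, k] = ![g * h, k] := by
    ext i; fin_cases i <;> rfl
  have h2 : Fin.contractNth (1 : Fin 3) (· * ·) ![g, h, k] = ![g, h * k] := by
    ext i; fin_cases i <;> rfl
  have h3 : Fin.contractNth (2 : Fin 3) (· * ·) ![g, h, k] = ![g, h] := by
    ext i; fin_cases i <;> rfl
  rw [d_cell_vertical, Fin.sum_univ_three, h0, h1, h2, h3]
  simp [sub_eq_add_neg, add_assoc, pow_succ]

lemma d_cell_one_zero (q : ℕ) (v : Fin q → X.obj (.op (.mk 1))) :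
    ((integralBicomplex X).d 1 0).f q (cell X 1 q v) =
      cell X 0 q (fun j => X.δ 0 (v j)) - cell X 0 q (fun j => X.δ 1 (v j)) := by
  rw [d_cell_horizontal, Fin.sum_univ_two]
  simp [sub_eq_add_neg]

lemma d_cell_two_one (q : ℕ) (v : Fin q → X.obj (.op (.mk 2))) :
    ((integralBicomplex X).d 2 1).f q (cell X 2 q v) =
      cell X 1 q (fun j => X.δ 0 (v j)) - cell X 1 q (fun j => X.δ 1 (v j)) +
        cell X 1 q (fun j => X.δ 2 (v j)) := by
  rw [d_cell_horizontal, Fin.sum_univ_three]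
  simp [sub_eq_add_neg]

lemma d_cell_three_two (v : Fin 0 → X.obj (.op (.mk 3))) :
    ((integralBicomplex X).d 3 2).f 0 (cell X 3 0 v) = 0 := by
  rw [d_cell_horizontal, Fin.sum_univ_four]
  simp only [Subsingleton.elim (fun j => X.δ _ (v j)) (Fin.elim0 : Fin 0 → X.obj (.op (.mk 2)))]
  simp [pow_succ]

/-- The basis element of bidegree `(0, 1)`. -/
abbrev gen01 (g : X.obj (.op (.mk 0))) : (tot X).X 1 := gen X 0 1 1 rfl ![g]

/-- The basis element of bidegree `(0, 2)`. -/
abbrev gen02 (g h : X.obj (.op (.mk 0))) : (tot X).X 2 := gen X 0 2 2 rfl ![g, h]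

/-- The basis element of bidegree `(1, 1)`. -/
abbrev gen11 (x : X.obj (.op (.mk 1))) : (tot X).X 2 := gen X 1 1 2 rfl ![x]

lemma d_gen02 (g h : X.obj (.op (.mk 0))) :
    (tot X).d 2 1 (gen02 X g h) = gen01 X h - gen01 X (g * h) + gen01 X g := by
  rw [d_gen_right X 2 1 1 rfl, d_cell_two, map_add, map_sub]
  rfl

lemma d_gen11 (x : X.obj (.op (.mk 1))) :
    (tot X).d 2 1 (gen11 X x) = gen01 X (X.δ 0 x) - gen01 X (X.δ 1 x) := by
  have h (i : Fin 2) : (fun j => X.δ i (![x] j)) = ![X.δ i x] := by ext j; fin_cases j; rfl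
  rw [d_gen X 1 1 0 0 1 rfl rfl, d_cell_one, d_cell_one_zero, h, h, map_sub, map_zero, smul_zero,
    add_zero]
  rfl

/-- Three equal faces with alternating signs leave one copy. Thus the generator of bidegree (1, 0)
is a boundary and contributes nothing to the homology. -/
lemma d_gen20 (v : Fin 0 → X.obj (.op (.mk 2))) :
    (tot X).d 2 1 (gen X 2 0 2 rfl v) = gen X 1 0 1 rfl Fin.elim0 := by
  rw [d_gen_left X 2 1 1 rfl, d_cell_two_one]
  simp only [Subsingleton.elim (fun j => X.δ _ (v j)) (Fin.elim0 : Fin 0 → X.obj (.op (.mk 1)))]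
  rw [sub_self, zero_add]
  rfl

lemma d_gen03 (g h k : X.obj (.op (.mk 0))) :
    (tot X).d 3 2 (gen X 0 3 3 rfl ![g, h, k]) =
      gen02 X h k - gen02 X (g * h) k + gen02 X g (h * k) - gen02 X g h := by
  rw [d_gen_right X 3 2 2 rfl, d_cell_three, map_sub, map_add, map_sub]
  rfl

lemma d_gen12 (x y : X.obj (.op (.mk 1))) :
    (tot X).d 3 2 (gen X 1 2 3 rfl ![x, y]) =
      gen02 X (X.δ 0 x) (X.δ 0 y) - gen02 X (X.δ 1 x) (X.δ 1 y) -
        (gen11 X y - gen11 X (x * y) + gen11 X x) := by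
  have h (i : Fin 2) : (fun j => X.δ i (![x, y] j)) = ![X.δ i x, X.δ i y] := by
    ext j; fin_cases j <;> rfl
  rw [d_gen X 1 2 0 1 2 rfl rfl, d_cell_two, d_cell_one_zero, h, h, map_sub, map_add, map_sub,
    pow_one, neg_one_smul, ← sub_eq_add_neg]
  rfl

lemma d_gen21 (x : X.obj (.op (.mk 2))) :
    (tot X).d 3 2 (gen X 2 1 3 rfl ![x]) =
      gen11 X (X.δ 0 x) - gen11 X (X.δ 1 x) + gen11 X (X.δ 2 x) := by
  have h (i : Fin 3) : (fun j => X.δ i (![x] j)) = ![X.δ i x] := by ext j; fin_cases j; rfl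
  rw [d_gen X 2 1 1 0 2 rfl rfl, d_cell_one, d_cell_two_one, h, h, h, map_add, map_sub, map_zero,
    smul_zero, add_zero]
  rfl

lemma d_gen30 (v : Fin 0 → X.obj (.op (.mk 3))) : (tot X).d 3 2 (gen X 3 0 3 rfl v) = 0 := by
  rw [d_gen_left X 3 2 2 rfl, d_cell_three_two, map_zero]

end SimplicialGroup

/-! ### The second homology group of the total complex -/

/-- An additive map between modules over `ℤ` is linear. -/
def homOfAddMonoidHom {A B : ModuleCat.{u} IntCoeff.{u}} (f : A →+ B) : A ⟶ B :=
  ModuleCat.ofHom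
    { f with
      map_smul' := fun n a =>
        map_intCast_smul f IntCoeff.{u} IntCoeff.{u} n.down a }

namespace SimplicialGroup

variable (X : SimplicialObject GrpCat.{u})

/-- The total chains of degree `2` modulo boundaries. -/
abbrev chainsModBoundaries : ModuleCat.{u} IntCoeff.{u} := (tot X).opcycles 2

/-- The class of the basis element `[g, h]` of bidegree `(0, 2)`. -/
def barClass (g h : X.obj (.op (.mk 0))) : chainsModBoundaries X :=
  (tot X).pOpcycles 2 (gen02 X g h)

/-- The class of the basis element `[x]` of bidegree `(1, 1)`. -/
def edgeClass (x : X.obj (.op (.mk 1))) : chainsModBoundaries X :=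
  (tot X).pOpcycles 2 (gen11 X x)

/-- The boundary map on total chains of degree `2` modulo boundaries. -/
def boundary : chainsModBoundaries X →+ (tot X).X 1 :=
  ((tot X).fromOpcycles 2 1).hom.toAddMonoidHom

lemma boundary_pOpcycles (a : (tot X).X 2) :
    boundary X ((tot X).pOpcycles 2 a) = (tot X).d 2 1 a :=
  ConcreteCategory.congr_hom ((tot X).p_fromOpcycles 2 1) a

lemma boundary_barClass (g h : X.obj (.op (.mk 0))) :
    boundary X (barClass X g h) = gen01 X h - gen01 X (g * h) + gen01 X g :=
  (boundary_pOpcycles X _).trans (d_gen02 X g h)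

lemma boundary_edgeClass (x : X.obj (.op (.mk 1))) :
    boundary X (edgeClass X x) = gen01 X (X.δ 0 x) - gen01 X (X.δ 1 x) :=
  (boundary_pOpcycles X _).trans (d_gen11 X x)

lemma pOpcycles_d (a : (tot X).X 3) : (tot X).pOpcycles 2 ((tot X).d 3 2 a) = 0 :=
  ConcreteCategory.congr_hom ((tot X).d_pOpcycles 3 2) a

lemma barClass_cocycle (g h k : X.obj (.op (.mk 0))) :
    barClass X h k - barClass X (g * h) k + barClass X g (h * k) - barClass X g h = 0 := by
  have := pOpcycles_d X (gen X 0 3 3 rfl ![g, h, k])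
  rwa [d_gen03, map_sub, map_add, map_sub] at this

lemma edgeClass_mul (x y : X.obj (.op (.mk 1))) :
    barClass X (X.δ 0 x) (X.δ 0 y) - barClass X (X.δ 1 x) (X.δ 1 y) -
      (edgeClass X y - edgeClass X (x * y) + edgeClass X x) = 0 := by
  have := pOpcycles_d X (gen X 1 2 3 rfl ![x, y])
  rwa [d_gen12, map_sub, map_sub, map_add, map_sub] at this

lemma edgeClass_face (x : X.obj (.op (.mk 2))) :
    edgeClass X (X.δ 0 x) - edgeClass X (X.δ 1 x) + edgeClass X (X.δ 2 x) = 0 := by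
  have := pOpcycles_d X (gen X 2 1 3 rfl ![x])
  rwa [d_gen21, map_add, map_sub] at this

lemma pOpcycles_surjective : Function.Surjective ((tot X).pOpcycles 2) :=
  (ModuleCat.epi_iff_surjective _).1 inferInstance

lemma fin_one_eq {α : Type*} (v : Fin 1 → α) : v = ![v 0] := by
  ext i; fin_cases i; rfl

lemma fin_two_eq {α : Type*} (v : Fin 2 → α) : v = ![v 0, v 1] := by
  ext i; fin_cases i <;> rfl

lemma fin_three_eq {α : Type*} (v : Fin 3 → α) : v = ![v 0, v 1, v 2] := by
  ext i; fin_cases i <;> rfl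

/-- The universal property of `chainsModBoundaries`. -/
lemma exists_desc {A : Type u} [AddCommGroup A]
    (f : X.obj (.op (.mk 0)) → X.obj (.op (.mk 0)) → A) (t : X.obj (.op (.mk 1)) → A)
    (hf : ∀ g h k, f h k - f (g * h) k + f g (h * k) - f g h = 0)
    (ht : ∀ x y, f (X.δ 0 x) (X.δ 0 y) - f (X.δ 1 x) (X.δ 1 y) - (t y - t (x * y) + t x) = 0)
    (hδ : ∀ x : X.obj (.op (.mk 2)), t (X.δ 0 x) - t (X.δ 1 x) + t (X.δ 2 x) = 0) :
    ∃ φ : chainsModBoundaries X →+ A,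
      (∀ g h, φ (barClass X g h) = f g h) ∧ ∀ x, φ (edgeClass X x) = t x := by
  let _ : Module IntCoeff.{u} A := ULift.module
  obtain ⟨ψ, hψ⟩ := exists_gen_desc X (n := 2) (A := ModuleCat.of IntCoeff.{u} A)
    fun p q _ => match p, q with
      | 0, 2 => fun v => f (v 0) (v 1)
      | 1, 1 => fun v => t (v 0)
      -- Only bidegree (2, 0) remains. It occurs in no boundary of a degree 3 generator, so any
      -- value would do.
      | _, _ => fun _ => 0
  have h02 (g h) : ψ (gen02 X g h) = f g h := hψ 0 2 rfl _
  have h11 (x) : ψ (gen11 X x) = t x := hψ 1 1 rfl _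
  have hd : (tot X).d 3 2 ≫ ψ = 0 := by
    refine gen_hom_ext X fun p q h v => ?_
    change ψ ((tot X).d 3 2 _) = 0
    obtain ⟨rfl, rfl⟩ | ⟨rfl, rfl⟩ | ⟨rfl, rfl⟩ | ⟨rfl, rfl⟩ :
        (p = 0 ∧ q = 3) ∨ (p = 1 ∧ q = 2) ∨ (p = 2 ∧ q = 1) ∨ (p = 3 ∧ q = 0) := by omega
    · rw [fin_three_eq v, d_gen03, map_sub, map_add, map_sub, h02, h02, h02, h02]
      exact hf _ _ _
    · rw [fin_two_eq v, d_gen12, map_sub, map_sub, map_add, map_sub, h02, h02, h11, h11, h11]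
      exact ht _ _
    · rw [fin_one_eq v, d_gen21, map_add, map_sub, h11, h11, h11]
      exact hδ _
    · rw [d_gen30, map_zero]
  let φ := (tot X).descOpcycles ψ 3 (by simp) hd
  have hφ (a) : φ ((tot X).pOpcycles 2 a) = ψ a :=
    ConcreteCategory.congr_hom ((tot X).p_descOpcycles ψ 3 (by simp) hd) a
  exact ⟨φ.hom.toAddMonoidHom, fun g h => (hφ _).trans (h02 g h), fun x => (hφ _).trans (h11 x)⟩

/-- An additive map which comes from chains of degree `1` on generators vanishes on cycles. -/
lemma eq_zero_of_boundary_eq_zero {A : Type u} [AddCommGroup A] (α : chainsModBoundaries X →+ A)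
    (s : X.obj (.op (.mk 0)) → A)
    (hb : ∀ g h, α (barClass X g h) = s h - s (g * h) + s g)
    (he : ∀ x, α (edgeClass X x) = s (X.δ 0 x) - s (X.δ 1 x))
    {z : chainsModBoundaries X} (hz : boundary X z = 0) : α z = 0 := by
  let _ : Module IntCoeff.{u} A := ULift.module
  obtain ⟨ψ, hψ⟩ := exists_gen_desc X (n := 1) (A := ModuleCat.of IntCoeff.{u} A)
    fun p q _ => match p, q with
      | 0, 1 => fun v => s (v 0)
      -- This value in bidegree (1, 0) is forced by `d_gen20`, as `ψ` composed with the differential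
      -- has to recover `α`.
      | _, _ => fun _ => α ((tot X).pOpcycles 2 (gen X 2 0 2 rfl Fin.elim0))
  have h01 (g) : ψ (gen01 X g) = s g := hψ 0 1 rfl _
  have h10 : ψ (gen X 1 0 1 rfl Fin.elim0) =
    α ((tot X).pOpcycles 2 (gen X 2 0 2 rfl Fin.elim0)) := hψ 1 0 rfl _
  have key : (tot X).d 2 1 ≫ ψ = (tot X).pOpcycles 2 ≫
      homOfAddMonoidHom (B := ModuleCat.of IntCoeff.{u} A) α := by
    refine gen_hom_ext X fun p q h v => ?_
    change ψ ((tot X).d 2 1 _) = α ((tot X).pOpcycles 2 _)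
    obtain ⟨rfl, rfl⟩ | ⟨rfl, rfl⟩ | ⟨rfl, rfl⟩ :
        (p = 0 ∧ q = 2) ∨ (p = 1 ∧ q = 1) ∨ (p = 2 ∧ q = 0) := by omega
    · rw [fin_two_eq v, d_gen02, map_add, map_sub, h01, h01, h01]
      exact (hb _ _).symm
    · rw [fin_one_eq v, d_gen11, map_sub, h01, h01]
      exact (he _).symm
    · rw [d_gen20, h10, Subsingleton.elim v Fin.elim0]
  obtain ⟨a, rfl⟩ := pOpcycles_surjective X z
  rw [boundary_pOpcycles] at hz
  have := ConcreteCategory.congr_hom key a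
  change ψ ((tot X).d 2 1 a) = α _ at this
  exact this.symm.trans (by rw [hz, map_zero])

/-- The second homology group is the kernel of the boundary map. -/
lemma nonempty_homology_addEquiv :
    Nonempty ((tot X).homology 2 ≃+ (boundary X).ker) := by
  let i : (tot X).homology 2 →+ chainsModBoundaries X := ((tot X).homologyι 2).hom.toAddMonoidHom
  have hi : Function.Injective i := (ModuleCat.mono_iff_injective _).1 inferInstance
  have hmem (z) : i z ∈ (boundary X).ker :=
    ConcreteCategory.congr_hom ((tot X).homologyι_comp_fromOpcycles 2 1) z
  refine ⟨AddEquiv.ofBijective (i.codRestrict _ hmem) ⟨fun a b h => hi congr($h.1), ?_⟩⟩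
  rintro ⟨z, hz⟩
  have hex : (ShortComplex.mk _ _ ((tot X).homologyι_comp_fromOpcycles 2 1)).Exact :=
    ShortComplex.exact_of_f_is_kernel _ ((tot X).homologyIsKernel 2 1 (by simp))
  obtain ⟨a, ha⟩ := (ShortComplex.moduleCat_exact_iff _).1 hex z hz
  exact ⟨a, Subtype.ext ha⟩

end SimplicialGroup

/-! ### Low-dimensional simplices of the nerve -/

namespace CrossedModule

variable {H G : Type u} [Group H] [Group G] (N : CrossedModule H G)

lemma nerveGroup_ext {n : ℕ} {x y : N.nerveGroup n} (h₁ : ∀ i, x.1.1 i = y.1.1 i)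
    (h₂ : ∀ p, (x.1.2 p).left = (y.1.2 p).left) : x = y := by
  refine Subtype.ext (Prod.ext (funext h₁) (funext fun p => SemidirectProduct.ext (h₂ p) ?_))
  rw [x.2.1 p, y.2.1 p, h₁]

/-- The simplex of the nerve with vertices `μ(u i) g`. -/
def simplex {n : ℕ} (u : Fin (n + 1) → H) (g : G) : N.nerveGroup n :=
  ⟨(fun i => N.hom (u i) * g, fun p => ⟨u p.1.1 * (u p.1.2)⁻¹, N.hom (u p.1.2) * g⟩),
    fun _ => rfl, fun p => by simp [mul_assoc], fun i => by simp,
    fun i j k _ _ => by simp [mul_assoc]⟩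

/-- The arrows out of the last vertex determine all others by the composition law. -/
lemma eq_simplex {n : ℕ} (x : N.nerveGroup n) :
    x = N.simplex (fun i => (x.1.2 ⟨(i, Fin.last n), Fin.le_last i⟩).left)
      (x.1.1 (Fin.last n)) := by
  refine N.nerveGroup_ext (fun i => ?_) fun p => ?_
  · rw [← x.2.2.1 ⟨(i, Fin.last n), Fin.le_last i⟩, x.2.1]
    rfl
  · exact eq_mul_inv_of_mul_eq (x.2.2.2.2 _ _ _ p.2 (Fin.le_last _)).symm

/-- The arrows only involve the quotients `u i * (u j)⁻¹`. This renormalises the last entry to 1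
after a face has deleted the last vertex. -/
lemma simplex_eq_of_mul {n : ℕ} (u : Fin (n + 1) → H) (k : H) (g : G) :
    N.simplex (fun i => u i * k) g = N.simplex u (N.hom k * g) := by
  refine N.nerveGroup_ext (fun i => ?_) fun p => ?_ <;> simp [simplex, mul_assoc]

/-- The Peiffer identity turns the action of `μ(u j)` into conjugation by `u j`, so the product
again has the form of a `simplex`. -/
lemma simplex_mul_simplex {n : ℕ} (u v : Fin (n + 1) → H) (g k : G) :
    N.simplex u g * N.simplex v k = N.simplex (fun i => u i * N.act g (v i)) (g * k) := by
  refine N.nerveGroup_ext (fun i => ?_) fun p => ?_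
  · simp [simplex, N.hom_act, mul_assoc]
  · simp [simplex, N.peiffer, mul_assoc]

/-- The vertex `g` of the nerve. -/
def vertex (g : G) : N.nerve.obj (.op (.mk 0)) := N.simplex (fun _ => 1) g

/-- The edge of the nerve from `g` to `μ(h) g`. -/
def edge (h : H) (g : G) : N.nerve.obj (.op (.mk 1)) := N.simplex ![h, 1] g

/-- The triangle of the nerve with vertices `μ(h' h) g`, `μ(h) g` and `g`. -/
def triangle (h' h : H) (g : G) : N.nerve.obj (.op (.mk 2)) := N.simplex ![h' * h, h, 1] g

lemma vertex_surjective : Function.Surjective N.vertex := fun (x : N.nerveGroup 0) => by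
  refine ⟨x.1.1 0, (Eq.trans (N.eq_simplex x) ?_).symm⟩
  refine congrArg (N.simplex · _) (funext fun i => ?_)
  fin_cases i
  exact x.2.2.2.1 0

lemma edge_surjective (x : N.nerve.obj (.op (.mk 1))) : ∃ h g, N.edge h g = x := by
  change N.nerveGroup 1 at x
  refine ⟨(x.1.2 ⟨(0, 1), Fin.zero_le _⟩).left, x.1.1 1, (Eq.trans (N.eq_simplex x) ?_).symm⟩
  refine congrArg (N.simplex · _) (funext fun i => ?_)
  fin_cases i
  · rfl
  · exact x.2.2.2.1 1

lemma triangle_surjective (x : N.nerve.obj (.op (.mk 2))) :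
    ∃ h' h g, N.triangle h' h g = x := by
  change N.nerveGroup 2 at x
  refine ⟨(x.1.2 ⟨(0, 1), Fin.zero_le _⟩).left, (x.1.2 ⟨(1, 2), by decide⟩).left, x.1.1 2,
    (Eq.trans (N.eq_simplex x) ?_).symm⟩
  refine congrArg (N.simplex · _) (funext fun i => ?_)
  fin_cases i
  · exact x.2.2.2.2 0 1 2 (by decide) (by decide)
  · rfl
  · exact x.2.2.2.1 2

lemma vertex_mul (g k : G) : N.vertex g * N.vertex k = N.vertex (g * k) :=
  (N.simplex_mul_simplex _ _ _ _).trans (by simp [vertex])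

lemma edge_mul (h h' : H) (g g' : G) :
    N.edge h g * N.edge h' g' = N.edge (h * N.act g h') (g * g') := by
  refine (N.simplex_mul_simplex _ _ _ _).trans (congrArg (N.simplex · _) (funext fun i => ?_))
  fin_cases i <;> simp

lemma δ_simplex {n : ℕ} (i : Fin (n + 2)) (u : Fin (n + 2) → H) (g : G) :
    N.nerve.δ i (N.simplex u g : N.nerve.obj (.op (.mk (n + 1)))) =
      (N.simplex (u ∘ i.succAbove) g : N.nerve.obj (.op (.mk n))) := rfl

lemma δ_zero_edge (h : H) (g : G) : N.nerve.δ 0 (N.edge h g) = N.vertex g :=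
  (N.δ_simplex _ _ _).trans <| congrArg (N.simplex · _) <| funext fun i => by fin_cases i; rfl

lemma δ_one_edge (h : H) (g : G) : N.nerve.δ 1 (N.edge h g) = N.vertex (N.hom h * g) := by
  refine (N.δ_simplex _ _ _).trans (Eq.trans ?_ (N.simplex_eq_of_mul (fun _ => 1) h g))
  refine congrArg (N.simplex · _) <| funext fun i => ?_
  fin_cases i
  exact (one_mul h).symm

lemma δ_zero_triangle (h' h : H) (g : G) : N.nerve.δ 0 (N.triangle h' h g) = N.edge h g :=
  (N.δ_simplex _ _ _).trans <| congrArg (N.simplex · _) <| funext fun i => by fin_cases i <;> rfl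

lemma δ_one_triangle (h' h : H) (g : G) : N.nerve.δ 1 (N.triangle h' h g) = N.edge (h' * h) g :=
  (N.δ_simplex _ _ _).trans <| congrArg (N.simplex · _) <| funext fun i => by fin_cases i <;> rfl

lemma δ_two_triangle (h' h : H) (g : G) :
    N.nerve.δ 2 (N.triangle h' h g) = N.edge h' (N.hom h * g) := by
  refine (N.δ_simplex _ _ _).trans (Eq.trans ?_ (N.simplex_eq_of_mul ![h', 1] h g))
  refine congrArg (N.simplex · _) <| funext fun i => ?_
  fin_cases i
  · rfl
  · exact (one_mul h).symm

/-! ### Chains of degree two modulo boundaries for a crossed module -/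

open SimplicialGroup

/-- The total chains of degree `2` modulo boundaries of the nerve. -/
abbrev chains₂ : Type u := chainsModBoundaries N.nerve

/-- The class `[g, k]` in `N.chains₂`. -/
def bar (g k : G) : N.chains₂ := barClass N.nerve (N.vertex g) (N.vertex k)

/-- The class of the edge from `g` to `μ(h) g` in `N.chains₂`. -/
def arrow (h : H) (g : G) : N.chains₂ := edgeClass N.nerve (N.edge h g)

/-- The class of `g` in the chains of degree `1`. -/
def point (g : G) : (tot N.nerve).X 1 := gen01 N.nerve (N.vertex g)

/-- This relation and the next two are the boundaries of the generators of bidegrees (0, 3), (1, 2)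
and (2, 1); bidegree (3, 0) gives none. -/
lemma bar_cocycle (g h k : G) :
    N.bar h k - N.bar (g * h) k + N.bar g (h * k) - N.bar g h = 0 := by
  simp only [bar, ← vertex_mul]
  exact barClass_cocycle _ _ _ _

lemma arrow_mul (h h' : H) (g g' : G) :
    N.arrow (h * N.act g h') (g * g') =
      N.arrow h g + N.arrow h' g' - N.bar g g' + N.bar (N.hom h * g) (N.hom h' * g') := by
  have := edgeClass_mul N.nerve (N.edge h g) (N.edge h' g')
  rw [edge_mul, δ_zero_edge, δ_zero_edge, δ_one_edge, δ_one_edge] at this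
  change N.bar g g' - N.bar (N.hom h * g) (N.hom h' * g') -
    (N.arrow h' g' - N.arrow (h * N.act g h') (g * g') + N.arrow h g) = 0 at this
  rw [← sub_eq_zero, ← this]
  abel

lemma arrow_comp (h' h : H) (g : G) :
    N.arrow (h' * h) g = N.arrow h' (N.hom h * g) + N.arrow h g := by
  have := edgeClass_face N.nerve (N.triangle h' h g)
  rw [δ_zero_triangle, δ_one_triangle, δ_two_triangle] at this
  change N.arrow h g - N.arrow (h' * h) g + N.arrow h' (N.hom h * g) = 0 at this
  rw [eq_comm, ← sub_eq_zero, ← this]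
  abel

lemma boundary_bar (g k : G) :
    boundary N.nerve (N.bar g k) = N.point k - N.point (g * k) + N.point g := by
  simp only [point, ← vertex_mul]
  exact boundary_barClass _ _ _

lemma boundary_arrow (h : H) (g : G) :
    boundary N.nerve (N.arrow h g) = N.point g - N.point (N.hom h * g) := by
  refine (boundary_edgeClass _ _).trans ?_
  rw [δ_zero_edge, δ_one_edge]
  rfl

/-- The universal property of `N.chains₂`. -/
lemma exists_chains₂_desc {A : Type u} [AddCommGroup A] (f : G → G → A) (t : H → G → A)
    (hf : ∀ g h k, f h k - f (g * h) k + f g (h * k) - f g h = 0)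
    (ht : ∀ h h' g g', t (h * N.act g h') (g * g') =
      t h g + t h' g' - f g g' + f (N.hom h * g) (N.hom h' * g'))
    (hc : ∀ h' h g, t (h' * h) g = t h' (N.hom h * g) + t h g) :
    ∃ φ : N.chains₂ →+ A, (∀ g k, φ (N.bar g k) = f g k) ∧ ∀ h g, φ (N.arrow h g) = t h g := by
  obtain ⟨v, hv⟩ : ∃ v : N.nerve.obj (.op (.mk 0)) → G, ∀ g, v (N.vertex g) = g :=
    ⟨fun x => x.1.1 0, fun g => by simp [vertex, simplex]⟩
  obtain ⟨l, r, hl, hr⟩ : ∃ (l : N.nerve.obj (.op (.mk 1)) → H) (r : N.nerve.obj (.op (.mk 1)) → G),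
      (∀ h g, l (N.edge h g) = h) ∧ ∀ h g, r (N.edge h g) = g :=
    ⟨fun x => (x.1.2 ⟨(0, 1), Fin.zero_le _⟩).left, fun x => x.1.1 1,
      fun h g => by simp [edge, simplex], fun h g => by simp [edge, simplex]⟩
  obtain ⟨φ, h₁, h₂⟩ := exists_desc N.nerve (fun x y => f (v x) (v y)) (fun x => t (l x) (r x))
    (fun x y z => by
      obtain ⟨x, rfl⟩ := N.vertex_surjective x
      obtain ⟨y, rfl⟩ := N.vertex_surjective y
      obtain ⟨z, rfl⟩ := N.vertex_surjective z
      simpa only [vertex_mul, hv] using hf x y z)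
    (fun x y => by
      obtain ⟨h, g, rfl⟩ := N.edge_surjective x
      obtain ⟨h', g', rfl⟩ := N.edge_surjective y
      rw [edge_mul]
      simp only [δ_zero_edge, δ_one_edge, hv, hl, hr, ht]
      abel)
    (fun x => by
      obtain ⟨h', h, g, rfl⟩ := N.triangle_surjective x
      simp only [δ_zero_triangle, δ_one_triangle, δ_two_triangle, hl, hr, hc]
      abel)
  refine ⟨φ, fun g k => (h₁ _ _).trans ?_, fun h g => (h₂ _).trans ?_⟩
  · simp only [hv]
  · simp only [hl, hr]

/-- An additive map which comes from chains of degree `1` on generators vanishes on cycles. -/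
lemma eq_zero_of_boundary_eq_zero {A : Type u} [AddCommGroup A] (α : N.chains₂ →+ A)
    (s : G → A)
    (hb : ∀ g k, α (N.bar g k) = s k - s (g * k) + s g)
    (ha : ∀ h g, α (N.arrow h g) = s g - s (N.hom h * g))
    {z : N.chains₂} (hz : boundary N.nerve z = 0) : α z = 0 := by
  obtain ⟨v, hv⟩ : ∃ v : N.nerve.obj (.op (.mk 0)) → G, ∀ g, v (N.vertex g) = g :=
    ⟨fun x => x.1.1 0, fun g => by simp [vertex, simplex]⟩
  refine SimplicialGroup.eq_zero_of_boundary_eq_zero N.nerve α (fun x => s (v x))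
    (fun x y => ?_) (fun x => ?_) hz
  · obtain ⟨x, rfl⟩ := N.vertex_surjective x
    obtain ⟨y, rfl⟩ := N.vertex_surjective y
    refine (hb x y).trans ?_
    simp only [vertex_mul, hv]
  · obtain ⟨h, g, rfl⟩ := N.edge_surjective x
    refine (ha h g).trans ?_
    simp only [δ_zero_edge, δ_one_edge, hv]

end CrossedModule

/-! ### Central extensions of crossed modules -/

namespace CrossedModule

variable {H G : Type u} [Group H] [Group G] {N : CrossedModule H G}

/-- A central extension `(H, D)` of a crossed module `(H, G, μ)` which is the identity on `H`. -/
structure CentralExtension (N : CrossedModule H G) (D : Type u) [Group D] where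
  /-- the projection `D → G` -/
  proj : D →* G
  /-- the structure homomorphism `H → D` -/
  lift : H →* D
  proj_surjective : Function.Surjective proj
  ker_le_center : proj.ker ≤ Subgroup.center D
  proj_lift : ∀ h, proj (lift h) = N.hom h
  conj_lift : ∀ d h, d * lift h * d⁻¹ = lift (N.act (proj d) h)

namespace CentralExtension

variable {D D' : Type u} [Group D] [Group D']

/-- The abelian group `(im(H) [D, D]) ∩ ker(D → G)`. -/
def hopfSubgroup (E : CentralExtension N D) : Subgroup D :=
  (E.lift.range ⊔ ⁅(⊤ : Subgroup D), (⊤ : Subgroup D)⁆) ⊓ E.proj.ker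

/-- Compatibility of a homomorphism with the structure of central extensions. -/
structure IsHom (E : CentralExtension N D) (E' : CentralExtension N D') (f : D →* D') : Prop where
  proj : ∀ d, E'.proj (f d) = E.proj d
  lift : ∀ h, f (E.lift h) = E'.lift h

variable {E : CentralExtension N D} {E' : CentralExtension N D'}

lemma IsHom.map_mem_hopfSubgroup {f : D →* D'} (hf : IsHom E E' f) {d : D}
    (hd : d ∈ E.hopfSubgroup) : f d ∈ E'.hopfSubgroup := by
  have hle : E.lift.range ⊔ ⁅(⊤ : Subgroup D), (⊤ : Subgroup D)⁆ ≤
      (E'.lift.range ⊔ ⁅(⊤ : Subgroup D'), (⊤ : Subgroup D')⁆).comap f := by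
    refine sup_le ?_ (Subgroup.commutator_le.2 fun x _ y _ => ?_)
    · rintro _ ⟨h, rfl⟩
      exact Subgroup.mem_sup_left ⟨h, (hf.lift h).symm⟩
    · rw [Subgroup.mem_comap, map_commutatorElement]
      exact Subgroup.mem_sup_right (Subgroup.commutator_mem_commutator trivial trivial)
  exact ⟨hle hd.1, (hf.proj d).trans hd.2⟩

lemma mem_center_of_proj_eq {x y : D} (h : E.proj x = E.proj y) :
    x * y⁻¹ ∈ Subgroup.center D :=
  E.ker_le_center (by rw [MonoidHom.mem_ker, map_mul, map_inv, h, mul_inv_cancel])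

lemma central_mul_conj {c : D} (hc : ∀ d, d * c = c * d) (x y : D) :
    c * x * y * (c * x)⁻¹ = x * y * x⁻¹ := by
  rw [← hc, mul_inv_rev]
  calc x * c * y * (c⁻¹ * x⁻¹) = x * (c * y) * c⁻¹ * x⁻¹ := by group
    _ = _ := by rw [← hc]; group

/-- Two homomorphisms of central extensions agree on the Hopf subgroup. -/
lemma IsHom.eqOn_hopfSubgroup {f g : D →* D'} (hf : IsHom E E' f) (hg : IsHom E E' g) {d : D}
    (hd : d ∈ E.hopfSubgroup) : f d = g d := by
  have hle : E.lift.range ⊔ ⁅(⊤ : Subgroup D), (⊤ : Subgroup D)⁆ ≤ f.eqLocus g := by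
    refine sup_le ?_ (Subgroup.commutator_le.2 fun x _ y _ => ?_)
    · rintro _ ⟨h, rfl⟩
      exact (hf.lift h).trans (hg.lift h).symm
    -- Both maps lie over `G`, so they differ by elements of the central kernel, and commutators do
    -- not see these.
    · have key (z : D) : ∃ c ∈ Subgroup.center D', f z = c * g z :=
        ⟨f z * (g z)⁻¹, E'.mem_center_of_proj_eq ((hf.proj z).trans (hg.proj z).symm), by simp⟩
      obtain ⟨c, hc, hx⟩ := key x
      obtain ⟨c', hc', hy⟩ := key y
      rw [Subgroup.mem_center_iff] at hc hc'
      change f (x * y * x⁻¹ * y⁻¹) = g (x * y * x⁻¹ * y⁻¹)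
      simp only [map_mul, map_inv, hx, hy]
      rw [central_mul_conj hc, mul_assoc, mul_assoc, ← mul_assoc (c' * g y), central_mul_conj hc']
      simp only [mul_assoc]
  exact hle hd.1

/-- Homomorphisms of central extensions in both directions identify the Hopf subgroups. -/
def hopfSubgroupEquiv {f : D →* D'} {g : D' →* D} (hf : IsHom E E' f) (hg : IsHom E' E g) :
    E.hopfSubgroup ≃* E'.hopfSubgroup where
  toFun d := ⟨f d, hf.map_mem_hopfSubgroup d.2⟩
  invFun d := ⟨g d, hg.map_mem_hopfSubgroup d.2⟩
  map_mul' _ _ := Subtype.ext (map_mul f _ _)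
  left_inv d := Subtype.ext <| by
    -- The composite need not be the identity of `D`, but it agrees with it on the Hopf subgroup.
    have h : IsHom E E (g.comp f) :=
      ⟨fun d => (hg.proj _).trans (hf.proj d),
        fun h => (congrArg g (hf.lift h)).trans (hg.lift h)⟩
    exact h.eqOn_hopfSubgroup (g := MonoidHom.id D) ⟨fun _ => rfl, fun _ => rfl⟩ d.2
  right_inv d := Subtype.ext <| by
    have h : IsHom E' E' (f.comp g) :=
      ⟨fun d => (hf.proj _).trans (hg.proj d),
        fun h => (congrArg f (hg.lift h)).trans (hf.lift h)⟩
    exact h.eqOn_hopfSubgroup (g := MonoidHom.id D') ⟨fun _ => rfl, fun _ => rfl⟩ d.2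

end CentralExtension

/-! ### The universal central extension with a section -/

section Universal

open SimplicialGroup

variable (N)

/-- The bar complex is not normalised, so `N.bar 1 1` need not vanish; it is the source of all the
correction terms below. -/
lemma bar_one_left (g : G) : N.bar 1 g = N.bar 1 1 := by
  have := N.bar_cocycle 1 1 g
  simpa [sub_eq_zero] using this

lemma bar_one_right (g : G) : N.bar g 1 = N.bar 1 1 := by
  have := N.bar_cocycle g 1 1
  simpa [sub_eq_zero, eq_comm] using this

lemma arrow_one (g : G) : N.arrow 1 g = 0 := by
  simpa using N.arrow_comp 1 1 g

/-- Here the edge `(h, g)` is factored as `(h, 1) * (1, g)`; `arrow_act` uses `(1, g) * (h, 1)`.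
Comparing the two factorisations gives the equivariance of the lift of `H`. -/
lemma arrow_eq (h : H) (g : G) :
    N.arrow h g = N.arrow h 1 - N.bar 1 1 + N.bar (N.hom h) g := by
  have := N.arrow_mul h 1 1 g
  simpa [arrow_one, bar_one_left] using this

lemma arrow_act (h : H) (g : G) :
    N.arrow (N.act g h) g = N.arrow h 1 - N.bar 1 1 + N.bar g (N.hom h) := by
  have := N.arrow_mul 1 h g 1
  simpa [arrow_one, bar_one_right] using this

/-- The central extension of `G` by `N.chains₂` given by the cocycle `N.bar`. -/
@[ext]
structure Universal where
  /-- the component in `N.chains₂` -/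
  chain : N.chains₂
  /-- the component in `G` -/
  base : G

namespace Universal

instance : Mul (Universal N) :=
  ⟨fun x y => ⟨x.chain + y.chain + N.bar x.base y.base, x.base * y.base⟩⟩

instance : One (Universal N) := ⟨⟨-N.bar 1 1, 1⟩⟩

instance : Inv (Universal N) :=
  ⟨fun x => ⟨-x.chain - N.bar x.base⁻¹ x.base - N.bar 1 1, x.base⁻¹⟩⟩

variable {N}

lemma mul_chain (x y : Universal N) : (x * y).chain = x.chain + y.chain + N.bar x.base y.base := rfl

lemma mul_base (x y : Universal N) : (x * y).base = x.base * y.base := rfl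

lemma one_chain : (1 : Universal N).chain = -N.bar 1 1 := rfl

lemma one_base : (1 : Universal N).base = 1 := rfl

lemma inv_chain (x : Universal N) :
    x⁻¹.chain = -x.chain - N.bar x.base⁻¹ x.base - N.bar 1 1 := rfl

lemma inv_base (x : Universal N) : x⁻¹.base = x.base⁻¹ := rfl

instance : Group (Universal N) := Group.ofLeftAxioms
  (fun x y z => Universal.ext (by
      have := N.bar_cocycle x.base y.base z.base
      simp only [mul_chain, mul_base]
      rw [← sub_eq_zero, ← neg_eq_zero, ← this]
      abel) (mul_assoc _ _ _))
  (fun x => Universal.ext (by simp [mul_chain, one_chain, one_base, bar_one_left])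
    (one_mul _))
  (fun x => Universal.ext (by
      simp only [mul_chain, inv_chain, inv_base, one_chain]
      abel) (inv_mul_cancel _))

variable (N)

/-- The structure of a central extension of crossed modules on `Universal N`. -/
def extension : CentralExtension N (Universal N) where
  proj := ⟨⟨base, rfl⟩, fun _ _ => rfl⟩
  -- The shift absorbs the term `N.bar 1 1` in `arrow_mul`, which makes the map multiplicative.
  lift := MonoidHom.mk' (fun h => ⟨N.arrow h 1 - N.bar 1 1, N.hom h⟩) fun h h' =>
    Universal.ext (by
      have := N.arrow_mul h h' 1 1
      simp only [map_one, MulAut.one_apply, mul_one] at this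
      change N.arrow (h * h') 1 - N.bar 1 1 = N.arrow h 1 - N.bar 1 1 +
        (N.arrow h' 1 - N.bar 1 1) + N.bar (N.hom h) (N.hom h')
      rw [this]
      abel) (map_mul _ _ _)
  proj_surjective g := ⟨⟨0, g⟩, rfl⟩
  ker_le_center x hx := Subgroup.mem_center_iff.2 fun y => by
    have hx : x.base = 1 := hx
    refine Universal.ext ?_ ?_
    · simp only [mul_chain, hx, bar_one_left, bar_one_right]
      abel
    · simp [mul_base, hx]
  proj_lift _ := rfl
  conj_lift x h := mul_inv_eq_of_eq_mul <| Universal.ext (by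
      change x.chain + (N.arrow h 1 - N.bar 1 1) + N.bar x.base (N.hom h) =
        N.arrow (N.act x.base h) 1 - N.bar 1 1 + x.chain + N.bar (N.hom (N.act x.base h)) x.base
      have h₁ := N.arrow_act h x.base
      rw [arrow_eq] at h₁
      rw [← sub_eq_zero] at h₁ ⊢
      rw [← neg_eq_zero, ← h₁]
      abel)
    (by
      change x.base * N.hom h = N.hom (N.act x.base h) * x.base
      rw [N.hom_act, inv_mul_cancel_right])

/-- The inclusion of the kernel of the universal extension. -/
def incl : Multiplicative N.chains₂ →* Universal N :=
  MonoidHom.mk' (fun a => ⟨a.toAdd - N.bar 1 1, 1⟩) fun a b =>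
    Universal.ext (by
      change a.toAdd + b.toAdd - N.bar 1 1 =
        a.toAdd - N.bar 1 1 + (b.toAdd - N.bar 1 1) + N.bar 1 1
      abel) (mul_one _).symm

/-- The extension of the boundary map to the universal extension. -/
def boundaryHom : Universal N →* Multiplicative ((tot N.nerve).X 1) :=
  MonoidHom.mk' (fun x => .ofAdd (boundary N.nerve x.chain + N.point x.base)) fun x y => by
    -- The boundary of the cocycle is the coboundary of `point`, so adding `point` makes the map
    -- multiplicative.
    rw [← ofAdd_add, mul_chain, mul_base, map_add (boundary _), map_add (boundary _), boundary_bar]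
    refine congrArg Multiplicative.ofAdd ?_
    abel

lemma boundaryHom_incl (a : N.chains₂) :
    boundaryHom N (incl N (.ofAdd a)) = .ofAdd (boundary N.nerve a) := by
  change Multiplicative.ofAdd (boundary N.nerve (a - N.bar 1 1) + N.point 1) = _
  rw [map_sub, boundary_bar]
  simp

lemma incl_injective : Function.Injective (incl N) := fun a b h => by
  have := congrArg chain h
  exact Multiplicative.toAdd.injective (sub_left_injective this)

/-- The cocycle is recovered from the section `g ↦ ⟨0, g⟩`. Once the group is made abelian and the
image of `H` is killed, this and `incl_arrow_mul` are the hypotheses of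
`eq_zero_of_boundary_eq_zero`. -/
lemma incl_bar_mul (g k : G) :
    incl N (.ofAdd (N.bar g k)) * ⟨0, g * k⟩ = (⟨0, g⟩ * ⟨0, k⟩ : Universal N) :=
  Universal.ext (by
    change N.bar g k - N.bar 1 1 + 0 + N.bar 1 (g * k) = 0 + 0 + N.bar g k
    rw [N.bar_one_left (g * k)]
    abel) (one_mul _)

lemma incl_arrow_mul (h : H) (g : G) :
    incl N (.ofAdd (N.arrow h g)) * ⟨0, N.hom h * g⟩ = (extension N).lift h * ⟨0, g⟩ :=
  Universal.ext (by
    change N.arrow h g - N.bar 1 1 + 0 + N.bar 1 (N.hom h * g) =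
      N.arrow h 1 - N.bar 1 1 + 0 + N.bar (N.hom h) g
    rw [N.bar_one_left (N.hom h * g), arrow_eq N h g]
    abel) (one_mul _)

/-- `boundaryHom` kills commutators and the image of `H`, and restricts to the boundary on the
kernel of the projection. Conversely, in the abelianization modulo the image of `H`, the inclusion
of chains comes from a function on degree 1 generators, so it vanishes on cycles. -/
lemma mem_hopfSubgroup_iff (x : Universal N) :
    x ∈ (extension N).hopfSubgroup ↔
      ∃ z, boundary N.nerve z = 0 ∧ incl N (.ofAdd z) = x := by
  constructor
  · rintro ⟨hx, hx'⟩
    obtain ⟨z, rfl⟩ : ∃ z, incl N (.ofAdd z) = x :=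
      ⟨x.chain + N.bar 1 1, Universal.ext (add_sub_cancel_right _ _) (Eq.symm hx')⟩
    refine ⟨z, ?_, rfl⟩
    have hle : (extension N).lift.range ⊔ ⁅(⊤ : Subgroup (Universal N)), (⊤ : Subgroup _)⁆ ≤
        (boundaryHom N).ker := by
      refine sup_le ?_ (Abelianization.commutator_subset_ker _)
      rintro _ ⟨h, rfl⟩
      change Multiplicative.ofAdd (boundary N.nerve (N.arrow h 1 - N.bar 1 1) +
        N.point (N.hom h)) = 1
      rw [map_sub, boundary_bar, boundary_arrow]
      simp
    have := hle hx
    rw [MonoidHom.mem_ker, boundaryHom_incl] at this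
    exact Multiplicative.ofAdd.injective this
  · rintro ⟨z, hz, rfl⟩
    refine ⟨?_, rfl⟩
    let L := (extension N).lift.range.map (Abelianization.of (G := Universal N))
    let q : Universal N →* Abelianization (Universal N) ⧸ L :=
      (QuotientGroup.mk' L).comp Abelianization.of
    have hlift (h) : q ((extension N).lift h) = 1 :=
      (QuotientGroup.eq_one_iff _).2 ⟨_, ⟨h, rfl⟩, rfl⟩
    have key := N.eq_zero_of_boundary_eq_zero (MonoidHom.toAdditiveRight (q.comp (incl N)))
      (fun g => .ofMul (q ⟨0, g⟩)) (fun g k => ?_) (fun h g => ?_) hz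
    · have hq : q (incl N (.ofAdd z)) = 1 := key
      obtain ⟨_, ⟨h, rfl⟩, hh⟩ := (QuotientGroup.eq_one_iff _).1 hq
      have hc : ((extension N).lift h)⁻¹ * incl N (.ofAdd z) ∈
          (Abelianization.of (G := Universal N)).ker := by
        rw [MonoidHom.mem_ker, map_mul, map_inv, hh, inv_mul_cancel]
      rw [Abelianization.ker_of] at hc
      rw [← mul_inv_cancel_left ((extension N).lift h) (incl N (.ofAdd z))]
      exact Subgroup.mul_mem_sup ⟨h, rfl⟩ hc
    · have := congrArg q (incl_bar_mul N g k)
      rw [map_mul, map_mul] at this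
      refine Additive.toMul.injective ((eq_mul_inv_of_mul_eq this).trans ?_)
      change _ = q _ / q _ * q _
      rw [div_eq_mul_inv, mul_comm (q _) (q _), mul_right_comm]
    · have := congrArg q (incl_arrow_mul N h g)
      rw [map_mul, map_mul, hlift, one_mul] at this
      refine Additive.toMul.injective ((eq_mul_inv_of_mul_eq this).trans ?_)
      exact (div_eq_mul_inv _ _).symm

lemma nonempty_hopfSubgroup_equiv :
    Nonempty (Multiplicative (N.integralHomology 2) ≃* (extension N).hopfSubgroup) := by
  obtain ⟨e⟩ := nonempty_homology_addEquiv N.nerve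
  let i : Multiplicative (boundary N.nerve).ker →* (extension N).hopfSubgroup :=
    ((incl N).comp (AddMonoidHom.toMultiplicative (boundary N.nerve).ker.subtype)).codRestrict _
      fun z => (mem_hopfSubgroup_iff N _).2 ⟨_, z.toAdd.2, rfl⟩
  refine ⟨(AddEquiv.toMultiplicative e).trans (MulEquiv.ofBijective i ⟨fun a b h => ?_, ?_⟩)⟩
  · exact Multiplicative.toAdd.injective (Subtype.ext
      (Multiplicative.ofAdd.injective (incl_injective N congr($h.1))))
  · rintro ⟨x, hx⟩
    obtain ⟨z, hz, rfl⟩ := (mem_hopfSubgroup_iff N x).1 hx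
    exact ⟨.ofAdd ⟨z, hz⟩, rfl⟩

end Universal

end Universal

end CrossedModule

/-! ### Maps out of the universal central extension -/

namespace CrossedModule

namespace CentralExtension

variable {H G D : Type u} [Group H] [Group G] [Group D] {N : CrossedModule H G}

/-- The universal extension maps to every central extension. -/
lemma exists_isHom_universal (E : CentralExtension N D) :
    ∃ f : Universal N →* D, IsHom (Universal.extension N) E f := by
  obtain ⟨s, hs⟩ := E.proj_surjective.hasRightInverse
  have hcomm (k : E.proj.ker) (d : D) : d * k = k * d :=
    Subgroup.mem_center_iff.1 (E.ker_le_center k.2) d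
  let _ : CommGroup E.proj.ker :=
    { (inferInstance : Group E.proj.ker) with mul_comm := fun a b => Subtype.ext (hcomm b a) }
  -- `f` is the factor set of the section `s`, and `t` below measures its failure to respect left
  -- multiplication by the lift of `H`.
  obtain ⟨f, hf⟩ : ∃ f : G → G → E.proj.ker, ∀ g k, s g * s k = f g k * s (g * k) :=
    ⟨fun g k => ⟨s g * s k * (s (g * k))⁻¹, by
      rw [MonoidHom.mem_ker, map_mul, map_mul, map_inv, hs, hs, hs, mul_inv_cancel]⟩,
      fun g k => by simp⟩
  obtain ⟨t, ht⟩ : ∃ t : H → G → E.proj.ker,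
      ∀ h g, E.lift h * s g = t h g * s (N.hom h * g) :=
    ⟨fun h g => ⟨E.lift h * s g * (s (N.hom h * g))⁻¹, by
      rw [MonoidHom.mem_ker, map_mul, map_mul, map_inv, hs, hs, E.proj_lift, mul_inv_cancel]⟩,
      fun h g => by simp⟩
  have hmid (a x y : D) (k : E.proj.ker) : a * x * (k * y) = a * k * (x * y) := by
    rw [mul_assoc, ← mul_assoc x, hcomm]
    simp only [mul_assoc]
  have hf₃ (g h k : G) : f h k * f g (h * k) = f (g * h) k * f g h := by
    refine Subtype.ext (mul_right_cancel (b := s (g * h * k)) ?_)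
    change (f h k : D) * f g (h * k) * s (g * h * k) = f (g * h) k * f g h * s (g * h * k)
    trans s g * s h * s k
    · rw [mul_assoc (s g), hf h k, ← mul_assoc, hcomm (f h k), mul_assoc _ (s g), hf g (h * k),
        ← mul_assoc, mul_assoc g]
    · rw [hf g h, mul_assoc, hf (g * h) k, ← mul_assoc, hcomm (f (g * h) k)]
  have hact (g : G) (h : H) : s g * E.lift h = E.lift (N.act g h) * s g := by
    have := E.conj_lift (s g) h
    rwa [hs, mul_inv_eq_iff_eq_mul] at this
  have ht₁ (h h' : H) (g g' : G) : t (h * N.act g h') (g * g') * f g g' =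
      t h g * t h' g' * f (N.hom h * g) (N.hom h' * g') := by
    refine Subtype.ext (mul_right_cancel (b := s (N.hom h * g * (N.hom h' * g'))) ?_)
    change (t (h * N.act g h') (g * g') : D) * f g g' * _ =
      t h g * t h' g' * f (N.hom h * g) (N.hom h' * g') * _
    have hN : N.hom h * g * (N.hom h' * g') = N.hom (h * N.act g h') * (g * g') := by
      rw [map_mul, N.hom_act]
      group
    -- This product is evaluated in two ways: moving `s g` past `E.lift h'` by equivariance, or
    -- applying `ht` to each factor.
    trans E.lift h * s g * (E.lift h' * s g')
    · rw [hN, ← hcomm, mul_assoc, ← ht, ← mul_assoc, ← hcomm, mul_assoc, ← hf, map_mul,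
        mul_assoc, mul_assoc, ← mul_assoc (E.lift (N.act g h')), ← hact, mul_assoc]
    · rw [ht, ht, hmid, mul_assoc _ _ (s _), ← hf]
  have ht₂ (h' h : H) (g : G) : t (h' * h) g = t h' (N.hom h * g) * t h g := by
    refine Subtype.ext (mul_right_cancel (b := s (N.hom (h' * h) * g)) ?_)
    change (t (h' * h) g : D) * _ = t h' (N.hom h * g) * t h g * _
    rw [← ht, map_mul, mul_assoc, ht, ← mul_assoc, hcomm, mul_assoc, ht, ← mul_assoc, map_mul,
      mul_assoc, hcomm]
    simp only [mul_assoc]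
  obtain ⟨φ, h₁, h₂⟩ := N.exists_chains₂_desc (A := Additive E.proj.ker)
    (fun g k => .ofMul (f g k)) (fun h g => .ofMul (t h g))
    (fun g h k => by
      have := congrArg Additive.ofMul (hf₃ g h k)
      rw [ofMul_mul, ofMul_mul, ← sub_eq_zero] at this
      rw [← this]
      abel)
    (fun h h' g g' => by
      have := congrArg Additive.ofMul (ht₁ h h' g g')
      rw [ofMul_mul, ofMul_mul, ofMul_mul, ← eq_sub_iff_add_eq] at this
      rw [this]
      abel)
    (fun h' h g => congrArg Additive.ofMul (ht₂ h' h g))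
  have h₃ (x : N.chains₂) : E.proj (φ x).toMul = 1 := (φ x).toMul.2
  refine ⟨MonoidHom.mk' (fun x => (φ x.chain).toMul * s x.base) fun x y => ?_, fun x => ?_,
    fun h => ?_⟩
  · rw [Universal.mul_chain, Universal.mul_base, φ.map_add, φ.map_add, h₁]
    change ((φ x.chain).toMul * (φ y.chain).toMul * (f x.base y.base) : D) * s _ = _
    rw [mul_assoc, ← hf, hmid]
  · change E.proj ((φ x.chain).toMul * s x.base) = x.base
    rw [map_mul, h₃, hs, one_mul]
  · change ((φ (N.arrow h 1 - N.bar 1 1)).toMul : D) * s (N.hom h) = E.lift h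
    -- The section need not satisfy `s 1 = 1`; the shift by `N.bar 1 1` in the lift cancels this
    -- defect.
    have hf₁ : (f 1 1 : D) = s 1 := by simpa using (hf 1 1).symm
    rw [sub_eq_add_neg, φ.map_add, φ.map_neg, h₁, h₂]
    change (t h 1 : D) * (f 1 1 : D)⁻¹ * s (N.hom h) = E.lift h
    have := ht h 1
    rw [mul_one, ← hf₁] at this
    rw [eq_mul_inv_of_mul_eq this, mul_assoc, mul_assoc, ← Subgroup.coe_inv, hcomm]

end CentralExtension

/-! ### Free crossed modules and presentations -/

variable {H G : Type u} [Group H] [Group G] {N : CrossedModule H G}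

/-- The kernel of the second projection of a free product is the normal closure of the first
factor. -/
lemma ker_coprod_snd_le_normalClosure (A B : Type*) [Group A] [Group B] :
    (Monoid.Coprod.snd : Monoid.Coprod A B →* B).ker ≤
      Subgroup.normalClosure (Set.range (Monoid.Coprod.inl : A →* Monoid.Coprod A B)) := by
  intro x hx
  let K := Subgroup.normalClosure (Set.range (Monoid.Coprod.inl : A →* Monoid.Coprod A B))
  -- Modulo `K` the first factor dies, so the quotient map factors through the second projection.
  have key : QuotientGroup.mk' K =
      ((QuotientGroup.mk' K).comp Monoid.Coprod.inr).comp Monoid.Coprod.snd := by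
    refine Monoid.Coprod.hom_ext (MonoidHom.ext fun a => ?_) (MonoidHom.ext fun b => ?_)
    · simpa using Subgroup.subset_normalClosure (Set.mem_range_self a)
    · simp
  have hx' := DFunLike.congr_fun key x
  rw [MonoidHom.comp_apply _ Monoid.Coprod.snd, MonoidHom.mem_ker.1 hx, map_one] at hx'
  exact (QuotientGroup.eq_one_iff x).1 hx'

/-- A morphism from a free crossed module lifts to every central extension. -/
lemma exists_lift_of_isFree {R F D : Type u} [Group R] [Group F] [Group D]
    {M : CrossedModule R F} (hM : M.IsFree) (p : Hom M N) (E : CentralExtension N D) :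
    ∃ f : F →* D, (∀ x, E.proj (f x) = p.right x) ∧ ∀ r, f (M.hom r) = E.lift (p.left r) := by
  obtain ⟨X, e, hl, hr⟩ := hM
  obtain ⟨s, hs⟩ := E.proj_surjective.hasRightInverse
  have hx (a : FreeGroup X) : Monoid.Coprod.inl a ∈
      (Monoid.Coprod.snd : Monoid.Coprod (FreeGroup X) (FreeGroup X) →* FreeGroup X).ker := by
    simp
  -- On the first factor the values are forced by the lift of `H`; on the second, any preimages
  -- under the projection work.
  let φ : Monoid.Coprod (FreeGroup X) (FreeGroup X) →* D := Monoid.Coprod.lift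
    (FreeGroup.lift fun x => E.lift (p.left (e.left ⟨_, hx (.of x)⟩)))
    (FreeGroup.lift fun x => s (p.right (e.right (Monoid.Coprod.inr (.of x)))))
  have hφ : E.proj.comp φ = p.right.comp e.right := by
    refine Monoid.Coprod.hom_ext (FreeGroup.ext_hom _ _ fun x => ?_)
      (FreeGroup.ext_hom _ _ fun x => ?_)
    · have h₁ : N.hom (p.left (e.left ⟨_, hx (.of x)⟩)) =
          p.right (e.right (Monoid.Coprod.inl (.of x))) :=
        (p.comm _).trans (congrArg p.right (e.comm _))
      simpa [φ, E.proj_lift] using h₁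
    · simp [φ, hs _]
  have key (r) : φ ((free X).hom r) = E.lift (p.left (e.left r)) := by
    let j : FreeGroup X →* (Monoid.Coprod.snd : Monoid.Coprod (FreeGroup X) (FreeGroup X) →*
      FreeGroup X).ker := Monoid.Coprod.inl.codRestrict _ hx
    have hj : (φ.comp (free X).hom).comp j = ((E.lift.comp p.left).comp e.left).comp j :=
      FreeGroup.ext_hom _ _ fun x => by
        change φ (Monoid.Coprod.inl (.of x)) = E.lift (p.left (e.left ⟨_, hx (.of x)⟩))
        simp [φ]
    -- The locus of agreement contains the first factor and is normal by equivariance, hence it is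
    -- the whole kernel.
    let K := (φ.comp (free X).hom).eqLocus ((E.lift.comp p.left).comp e.left)
    have hK : (K.map (Subgroup.subtype _)).Normal := ⟨by
      rintro _ ⟨r, hr, rfl⟩ c
      refine ⟨(free X).act c r, ?_, rfl⟩
      change φ ((free X).hom r) = E.lift (p.left (e.left r)) at hr
      change φ ((free X).hom ((free X).act c r)) = E.lift (p.left (e.left ((free X).act c r)))
      have hc := DFunLike.congr_fun hφ c
      change E.proj (φ c) = p.right (e.right c) at hc
      rw [e.equivariant, p.equivariant, ← hc, ← E.conj_lift, ← hr, (free X).hom_act, map_mul,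
        map_mul, map_inv]⟩
    obtain ⟨r', hr', h⟩ := (ker_coprod_snd_le_normalClosure _ _).trans
      (Subgroup.normalClosure_le_normal (N := K.map (Subgroup.subtype _)) (by
        rintro _ ⟨a, rfl⟩
        exact ⟨j a, DFunLike.congr_fun hj a, rfl⟩)) r.2
    obtain rfl : r' = r := Subtype.ext h
    exact hr'
  let e' := MulEquiv.ofBijective e.right hr
  refine ⟨φ.comp e'.symm.toMonoidHom, fun x => ?_, fun r => ?_⟩
  · obtain ⟨x, rfl⟩ := e'.surjective x
    change E.proj (φ (e'.symm (e' x))) = _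
    rw [e'.symm_apply_apply]
    exact DFunLike.congr_fun hφ x
  · obtain ⟨r, rfl⟩ := hl.2 r
    rw [e.comm, ← key]
    exact congrArg φ (e'.symm_apply_apply _)

/-! ### The central extension attached to a presentation -/

namespace ShortExact

variable {R' F' R F : Type u} [Group R'] [Group F'] [Group R] [Group F]
  {M' : CrossedModule R' F'} {M : CrossedModule R F} (S : ShortExact M' M N)

/-- The homomorphism from `H` to the quotient of `F` by the denominator of the Hopf formula. -/
def liftHom : H →* F ⧸ S.hopfDenominator :=
  S.proj.left.liftOfSurjective S.proj_left_surjective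
    ⟨(QuotientGroup.mk' _).comp M.hom, by
      rw [← S.exact_left]
      rintro _ ⟨r, rfl⟩
      refine (QuotientGroup.eq_one_iff _).2 (Subgroup.mem_sup_left ⟨_, ⟨r, rfl⟩, ?_⟩)
      exact (S.incl.comm r).symm⟩

lemma liftHom_proj (r : R) : S.liftHom (S.proj.left r) = QuotientGroup.mk (M.hom r) :=
  MonoidHom.liftOfRightInverse_comp_apply _ _ _ _ _

/-- The central extension of `N` on the quotient of `F` by the denominator of the Hopf formula. -/
def centralExtension : CentralExtension N (F ⧸ S.hopfDenominator) where
  proj := QuotientGroup.lift _ S.proj.right <| (S.hopfDenominator_le_hopfNumerator.trans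
    inf_le_right).trans_eq S.exact_right
  lift := S.liftHom
  proj_surjective g := by
    obtain ⟨x, rfl⟩ := S.proj_right_surjective g
    exact ⟨QuotientGroup.mk x, rfl⟩
  ker_le_center x hx := Subgroup.mem_center_iff.2 fun y => by
    obtain ⟨x, rfl⟩ := QuotientGroup.mk_surjective x
    obtain ⟨y, rfl⟩ := QuotientGroup.mk_surjective y
    have hx' : x ∈ S.incl.right.range := S.exact_right ▸ hx
    refine (QuotientGroup.eq_iff_div_mem (N := S.hopfDenominator)).2 (Subgroup.mem_sup_right ?_)
    have := Subgroup.commutator_mem_commutator (Subgroup.mem_top y) hx'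
    rwa [commutatorElement_def, mul_assoc, ← mul_inv_rev, ← div_eq_mul_inv] at this
  proj_lift h := by
    obtain ⟨r, rfl⟩ := S.proj_left_surjective h
    rw [liftHom_proj]
    exact (S.proj.comm r).symm
  conj_lift d h := by
    obtain ⟨r, rfl⟩ := S.proj_left_surjective h
    obtain ⟨x, rfl⟩ := QuotientGroup.mk_surjective d
    change _ = S.liftHom (N.act (S.proj.right x) (S.proj.left r))
    rw [← S.proj.equivariant, liftHom_proj, liftHom_proj, M.hom_act]
    rfl

/-- A lift `F → D` kills `η'(R')`, because `R'` dies in `H`, and kills `[F, F']`, because `F'` lands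
in the central kernel. -/
lemma exists_isHom_of_isFree (hM : M.IsFree) {D : Type u} [Group D] (E : CentralExtension N D) :
    ∃ f : F ⧸ S.hopfDenominator →* D, S.centralExtension.IsHom E f := by
  obtain ⟨f, hp, hl⟩ := exists_lift_of_isFree hM S.proj E
  have hF' {x : F} (hx : x ∈ S.incl.right.range) : f x ∈ Subgroup.center D := by
    rw [S.exact_right] at hx
    exact E.ker_le_center ((hp x).trans hx)
  have hle : S.hopfDenominator ≤ f.ker := by
    refine sup_le ?_ (Subgroup.commutator_le.2 fun x _ y hy => ?_)
    · rintro _ ⟨_, ⟨r, rfl⟩, rfl⟩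
      have hr : S.incl.left r ∈ S.proj.left.ker := S.exact_left ▸ ⟨r, rfl⟩
      rw [MonoidHom.mem_ker, ← S.incl.comm, hl, MonoidHom.mem_ker.1 hr, map_one]
    · rw [MonoidHom.mem_ker, map_commutatorElement, commutatorElement_eq_one_iff_mul_comm]
      exact Subgroup.mem_center_iff.1 (hF' hy) _
  refine ⟨QuotientGroup.lift _ f hle, fun d => ?_, fun h => ?_⟩
  · obtain ⟨x, rfl⟩ := QuotientGroup.mk_surjective d
    exact hp x
  · obtain ⟨r, rfl⟩ := S.proj_left_surjective h
    refine (congrArg _ (S.liftHom_proj r)).trans (hl r)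

/-- Taking images commutes with the intersection here because the denominator lies in `F'`, so
membership in `F'` can be tested on any representative. -/
lemma hopfSubgroup_centralExtension :
    S.centralExtension.hopfSubgroup = S.hopfNumerator.map (QuotientGroup.mk' _) := by
  have hsup : S.centralExtension.lift.range ⊔
      ⁅(⊤ : Subgroup (F ⧸ S.hopfDenominator)), (⊤ : Subgroup (F ⧸ S.hopfDenominator))⁆ =
      (M.hom.range ⊔ ⁅(⊤ : Subgroup F), (⊤ : Subgroup F)⁆).map (QuotientGroup.mk' _) := by
    rw [Subgroup.map_sup, Subgroup.map_commutator, Subgroup.map_top_of_surjective _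
      (QuotientGroup.mk'_surjective _)]
    congr 1
    ext d
    constructor
    · rintro ⟨h, rfl⟩
      obtain ⟨r, rfl⟩ := S.proj_left_surjective h
      exact ⟨_, ⟨r, rfl⟩, (S.liftHom_proj r).symm⟩
    · rintro ⟨_, ⟨r, rfl⟩, rfl⟩
      exact ⟨_, S.liftHom_proj r⟩
  rw [CentralExtension.hopfSubgroup, hsup]
  ext d
  constructor
  · rintro ⟨⟨x, hx, rfl⟩, hx'⟩
    exact ⟨x, ⟨hx, S.exact_right ▸ hx'⟩, rfl⟩
  · rintro ⟨x, ⟨hx, hx'⟩, rfl⟩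
    rw [S.exact_right] at hx'
    exact ⟨⟨x, hx, rfl⟩, hx'⟩

/-- The quotient in the Hopf formula is the Hopf subgroup of the associated central extension. -/
def hopfQuotientEquiv :
    S.hopfNumerator ⧸ S.hopfDenominator.subgroupOf S.hopfNumerator ≃*
      S.centralExtension.hopfSubgroup :=
  let f := (QuotientGroup.mk' S.hopfDenominator).comp S.hopfNumerator.subtype
  (QuotientGroup.quotientMulEquivOfEq (by
    rw [← MonoidHom.comap_ker, QuotientGroup.ker_mk']
    rfl)).trans <| (QuotientGroup.quotientKerEquivRange f).trans <| MulEquiv.subgroupCongr <| by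
      rw [hopfSubgroup_centralExtension, MonoidHom.range_comp, Subgroup.range_subtype]

end ShortExact

end CrossedModule

end

theorem mainTheorem8 {R' F' R F H G : Type u} [Group R'] [Group F'] [Group R] [Group F]
    [Group H] [Group G] (M' : CrossedModule R' F') (M : CrossedModule R F) (N : CrossedModule H G)
    (P : CrossedModule.FreePresentation M' M N) :
    Nonempty (Multiplicative (N.integralHomology 2) ≃*
      P.hopfNumerator ⧸ P.hopfDenominator.subgroupOf P.hopfNumerator) := by
  obtain ⟨e⟩ := CrossedModule.Universal.nonempty_hopfSubgroup_equiv N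
  obtain ⟨f, hf⟩ := P.centralExtension.exists_isHom_universal
  obtain ⟨g, hg⟩ := P.exists_isHom_of_isFree P.isFree (CrossedModule.Universal.extension N)
  exact ⟨(e.trans (CrossedModule.CentralExtension.hopfSubgroupEquiv hf hg)).trans
    P.hopfQuotientEquiv.symm⟩
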